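/- For a function $g:\{0,1\}^n\to\mathbb R$ let $\mathbb E g=2^{-n}\sum_{x}g(x)$, and for $S\subseteq\{1,\dots,n\}$ let $\widehat g(S)=\mathbb E\,[g(x)(-1)^{\sum_{i\in S}x_i}]$. For $g\ge 0$ let $\mathrm{Ent}(g)=\mathbb E[g\log_2 g]-(\mathbb E g)\log_2(\mathbb E g)$, with $0\log_2 0=0$. For $0\le\epsilon\le 1/2$ let $(T_\epsilon g)(x)=\mathbb E\,g(Y)$, where $Y$ is obtained from $x$ by flipping each coordinate independently with probability $\epsilon$. **Lemma 1.3.** There exist absolute constants $C_1,C_2>0$ such that for every $n\ge 0$, every nonnegative, not identically zero function $f:\{0,1\}^n\to\mathbb R$ and every $0\le\epsilon\le 1/2$, with $\lambda=(1-2\epsilon)^2$, $$\mathrm{Ent}(T_\epsilon f)\;\le\;\frac{1}{\mathbb E f}\left(\frac{1}{2\ln 2}\sum_{k=1}^n\widehat f(\{k\})^2\right)\lambda\;+\;C_1\,\frac{\mathbb E [f^2]}{\mathbb E f}\,\lambda^{4/3}\;+\;C_2\,\frac{(\mathbb E [f^2])^2}{(\mathbb E f)^3}\,\lambda^2 .$$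 -/

import Mathlib

noncomputable section

namespace BoolCube

/-- The expectation `E f` of a function on the cube `{0,1}^n` under the uniform measure. -/
def expect {n : ℕ} (f : (Fin n → Bool) → ℝ) : ℝ :=
  (∑ x, f x) / 2 ^ n

/-- The Walsh character `W_S(x) = (-1)^{∑_{i ∈ S} x_i}`. -/
def walsh {n : ℕ} (S : Finset (Fin n)) (x : Fin n → Bool) : ℝ :=
  ∏ i ∈ S, (if x i then (-1 : ℝ) else 1)

/-- The Fourier coefficient of `f` at `S`, namely `E (f * W_S)`. -/
def fourier {n : ℕ} (f : (Fin n → Bool) → ℝ) (S : Finset (Fin n)) : ℝ :=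
  expect fun x => f x * walsh S x

/-- The noise operator: `(T_ε f)(x) = E f(Y)`, where `Y` is obtained from `x` by flipping each
coordinate independently with probability `ε`. -/
def noise {n : ℕ} (ε : ℝ) (f : (Fin n → Bool) → ℝ) (x : Fin n → Bool) : ℝ :=
  ∑ y, (∏ i, (if y i = x i then 1 - ε else ε)) * f y

/-- The entropy `Ent f = E (f log₂ f) - (E f) log₂ (E f)` of a nonnegative function on the cube
(with `0 log₂ 0 = 0`, which `Real.logb` gives). -/
def ent {n : ℕ} (f : (Fin n → Bool) → ℝ) : ℝ :=
  expect (fun x => f x * Real.logb 2 (f x)) - expect f * Real.logb 2 (expect f)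

end BoolCube

end

/-!
Normalise `𝔼 f = 1` and write `g = T_ε f = 1 + h` with `h = l + q`, where `l` is the degree one part
of `g` and `q` collects the degrees at least two. Taylor's formula gives
`(1 + h) log (1 + h) ≤ h + h² / 2 - h³ / 6 + h⁴ / 3`. Here `𝔼 h = 0`, and `𝔼 h² = 𝔼 l² + 𝔼 q²`
supplies the main term, as `𝔼 q²` has order `λ²`. Since `𝔼 l³ = 0` by parity, the cubic term is
controlled by `q²`, `h⁴` and `l⁴`, and the fourth moments have order `λ²` by Bonami's
hypercontractive inequality if `3 λ ≤ 1`. If `3 λ ≥ 1`, the bound `𝔼 (g log g) ≤ 𝔼 g²` is enough.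
Altogether the error has order `(𝔼 f²)² λ²`.
-/

namespace BoolCube

open Finset
open scoped BigOperators

variable {n : ℕ}

lemma expect_eq_finset_expect (f : (Fin n → Bool) → ℝ) : expect f = 𝔼 x, f x := by
  simp [expect, Fintype.expect_eq_sum_div_card]

lemma expect_nonneg {f : (Fin n → Bool) → ℝ} (hf : ∀ x, 0 ≤ f x) : 0 ≤ expect f := by
  rw [expect_eq_finset_expect]
  exact Finset.expect_nonneg fun x _ => hf x

lemma expect_pos {f : (Fin n → Bool) → ℝ} (hf : ∀ x, 0 ≤ f x) (hf0 : f ≠ 0) : 0 < expect f := by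
  obtain ⟨x, hx⟩ := Function.ne_iff.mp hf0
  rw [expect_eq_finset_expect]
  exact expect_pos' (fun x _ => hf x) ⟨x, mem_univ x, (hf x).lt_of_ne' hx⟩

lemma fourier_eq_expect (f : (Fin n → Bool) → ℝ) (S : Finset (Fin n)) :
    fourier f S = 𝔼 x, f x * walsh S x :=
  expect_eq_finset_expect _

lemma fourier_empty (f : (Fin n → Bool) → ℝ) : fourier f ∅ = 𝔼 x, f x := by
  simp [fourier_eq_expect, walsh]

lemma fourier_const_mul (a : ℝ) (f : (Fin n → Bool) → ℝ) (S : Finset (Fin n)) :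
    fourier (fun x => a * f x) S = a * fourier f S := by
  simp only [fourier_eq_expect, mul_assoc, mul_expect]

/-! ### Walsh functions and polynomials -/

lemma walsh_mul_self (S : Finset (Fin n)) (x : Fin n → Bool) : walsh S x * walsh S x = 1 := by
  rw [walsh, ← prod_mul_distrib]
  exact prod_eq_one fun i _ => by split_ifs <;> norm_num

lemma walsh_insert {i : Fin n} {S : Finset (Fin n)} (hi : i ∉ S) (x : Fin n → Bool) :
    walsh (insert i S) x = walsh {i} x * walsh S x := by
  simp [walsh, prod_insert hi]

/-- The permutation of the cube that flips the coordinates in `T`. It expresses the parity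
arguments: a function that it negates has mean zero. -/
def flipOn (T : Finset (Fin n)) : Equiv.Perm (Fin n → Bool) :=
  Function.Involutive.toPerm (fun x i => x i ^^ decide (i ∈ T)) fun x => by simp

lemma flipOn_apply (T : Finset (Fin n)) (x : Fin n → Bool) (i : Fin n) :
    flipOn T x i = (x i ^^ decide (i ∈ T)) := rfl

lemma walsh_flipOn (S T : Finset (Fin n)) (x : Fin n → Bool) :
    walsh S (flipOn T x) = (-1) ^ #(S ∩ T) * walsh S x := by
  rw [walsh, walsh, ← filter_mem_eq_inter, ← prod_const, prod_filter, ← prod_mul_distrib]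
  refine prod_congr rfl fun i _ => ?_
  by_cases hi : i ∈ T <;> cases hx : x i <;> simp [flipOn_apply, hi, hx]

lemma expect_eq_zero_of_comp_perm {α : Type*} [Fintype α] (e : Equiv.Perm α) {f : α → ℝ}
    (hf : ∀ x, f (e x) = -f x) : 𝔼 x, f x = 0 := by
  have h : 𝔼 x, -f x = 𝔼 x, f x := Fintype.expect_equiv e _ _ fun x => (hf x).symm
  rw [expect_neg_distrib] at h
  linarith

lemma expect_walsh_mul_walsh (S T : Finset (Fin n)) :
    𝔼 x, walsh S x * walsh T x = if S = T then 1 else 0 := by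
  split_ifs with hST
  · simp [hST, walsh_mul_self]
  · obtain ⟨i, hi⟩ : ∃ i, ¬(i ∈ S ↔ i ∈ T) := by simpa [Finset.ext_iff] using hST
    refine expect_eq_zero_of_comp_perm (flipOn {i}) fun x => ?_
    by_cases hS : i ∈ S <;> by_cases hT : i ∈ T <;> simp_all [walsh_flipOn]

/-- The multilinear polynomial with coefficients `c S`, `S ∈ 𝒮`, in the variables
`(-1) ^ x i`. For `c = fourier f` it is the projection of `f` to the frequencies in `𝒮`. -/
def walshSum (𝒮 : Finset (Finset (Fin n))) (c : Finset (Fin n) → ℝ) (x : Fin n → Bool) : ℝ :=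
  ∑ S ∈ 𝒮, c S * walsh S x

lemma fourier_walshSum (𝒮 : Finset (Finset (Fin n))) (c : Finset (Fin n) → ℝ)
    (T : Finset (Fin n)) : fourier (walshSum 𝒮 c) T = if T ∈ 𝒮 then c T else 0 := by
  simp only [fourier_eq_expect, walshSum, sum_mul, mul_assoc, expect_sum_comm, ← mul_expect,
    expect_walsh_mul_walsh, mul_ite, mul_one, mul_zero, sum_ite_eq']

lemma expect_mul_walshSum (f : (Fin n → Bool) → ℝ) (𝒮 : Finset (Finset (Fin n)))
    (c : Finset (Fin n) → ℝ) :
    𝔼 x, f x * walshSum 𝒮 c x = ∑ S ∈ 𝒮, c S * fourier f S := by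
  simp only [walshSum, fourier_eq_expect, mul_sum, mul_expect, expect_sum_comm, mul_left_comm]

lemma expect_walshSum_sq (𝒮 : Finset (Finset (Fin n))) (c : Finset (Fin n) → ℝ) :
    𝔼 x, walshSum 𝒮 c x ^ 2 = ∑ S ∈ 𝒮, c S ^ 2 := by
  simp only [sq, expect_mul_walshSum, fourier_walshSum]
  exact sum_congr rfl fun S hS => by rw [if_pos hS]

lemma expect_walshSum_pow_eq_zero {𝒮 : Finset (Finset (Fin n))} (h𝒮 : ∀ S ∈ 𝒮, Odd #S)
    (c : Finset (Fin n) → ℝ) {m : ℕ} (hm : Odd m) : 𝔼 x, walshSum 𝒮 c x ^ m = 0 := by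
  refine expect_eq_zero_of_comp_perm (flipOn univ) fun x => ?_
  have hodd : walshSum 𝒮 c (flipOn univ x) = -walshSum 𝒮 c x := by
    simp only [walshSum, ← sum_neg_distrib]
    exact sum_congr rfl fun S hS => by
      rw [walsh_flipOn, inter_univ, (h𝒮 S hS).neg_one_pow]; ring
  rw [hodd, hm.neg_pow]

/-! ### Bonami's hypercontractive inequality -/

lemma expect_add_walsh_mul_pow_four {i : Fin n} {u v : (Fin n → Bool) → ℝ}
    (hu : ∀ x, u (flipOn {i} x) = u x) (hv : ∀ x, v (flipOn {i} x) = v x) :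
    𝔼 x, (u x + walsh {i} x * v x) ^ 4 =
      𝔼 x, u x ^ 4 + 6 * 𝔼 x, u x ^ 2 * v x ^ 2 + 𝔼 x, v x ^ 4 := by
  have hodd : 𝔼 x, walsh {i} x * (4 * (u x ^ 3 * v x + u x * v x ^ 3)) = 0 :=
    expect_eq_zero_of_comp_perm (flipOn {i}) fun x => by simp [walsh_flipOn, hu, hv]
  have hexpand (x) : (u x + walsh {i} x * v x) ^ 4 =
      u x ^ 4 + 6 * (u x ^ 2 * v x ^ 2) + v x ^ 4 +
        walsh {i} x * (4 * (u x ^ 3 * v x + u x * v x ^ 3)) := by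
    linear_combination (6 * u x ^ 2 * v x ^ 2 + 4 * walsh {i} x * u x * v x ^ 3 +
      (walsh {i} x ^ 2 + 1) * v x ^ 4) * walsh_mul_self {i} x
  simp only [hexpand, expect_add_distrib, hodd, add_zero, mul_expect]

lemma expect_add_walsh_mul_pow_four_le {i : Fin n} {u v : (Fin n → Bool) → ℝ}
    (hu : ∀ x, u (flipOn {i} x) = u x) (hv : ∀ x, v (flipOn {i} x) = v x) {a b : ℝ}
    (ha : 0 ≤ a) (hb : 0 ≤ b) (hua : 𝔼 x, u x ^ 4 ≤ a ^ 2) (hvb : 𝔼 x, v x ^ 4 ≤ b ^ 2) :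
    𝔼 x, (u x + walsh {i} x * v x) ^ 4 ≤ (a + 3 * b) ^ 2 := by
  have hcauchy : (𝔼 x, u x ^ 2 * v x ^ 2) ^ 2 ≤ (𝔼 x, u x ^ 4) * 𝔼 x, v x ^ 4 := by
    have hsq (w : (Fin n → Bool) → ℝ) : 𝔼 x, w x ^ 4 = 𝔼 x, (w x ^ 2) ^ 2 :=
      expect_congr rfl fun x _ => by ring
    rw [hsq u, hsq v]
    exact expect_mul_sq_le_sq_mul_sq univ (fun x => u x ^ 2) (fun x => v x ^ 2)
  have hmixed : 𝔼 x, u x ^ 2 * v x ^ 2 ≤ a * b := by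
    refine le_of_sq_le_sq (hcauchy.trans ?_) (by positivity)
    rw [mul_pow]
    exact mul_le_mul hua hvb (Finset.expect_nonneg fun x _ => by positivity) (by positivity)
  rw [expect_add_walsh_mul_pow_four hu hv]
  linarith [sq_nonneg b]

lemma walshSum_powerset_flipOn {i : Fin n} {J : Finset (Fin n)} (hi : i ∉ J)
    (c : Finset (Fin n) → ℝ) (x : Fin n → Bool) :
    walshSum J.powerset c (flipOn {i} x) = walshSum J.powerset c x :=
  sum_congr rfl fun S hS => by
    have hiS : i ∉ S := fun h => hi (mem_powerset.mp hS h)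
    simp [walsh_flipOn, hiS]

lemma walshSum_powerset_insert {i : Fin n} {J : Finset (Fin n)} (hi : i ∉ J)
    (c : Finset (Fin n) → ℝ) (x : Fin n → Bool) :
    walshSum (insert i J).powerset c x =
      walshSum J.powerset c x + walsh {i} x * walshSum J.powerset (fun S => c (insert i S)) x := by
  simp only [walshSum, sum_powerset_insert hi, mul_sum]
  congr 1
  refine sum_congr rfl fun S hS => ?_
  rw [walsh_insert fun h => hi (mem_powerset.mp hS h), mul_left_comm]

lemma expect_walshSum_powerset_pow_four_le (J : Finset (Fin n)) (c : Finset (Fin n) → ℝ) :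
    𝔼 x, walshSum J.powerset c x ^ 4 ≤ (∑ S ∈ J.powerset, 3 ^ #S * c S ^ 2) ^ 2 := by
  induction J using Finset.induction_on generalizing c with
  | empty => simp [walshSum, walsh, ← pow_mul]
  | insert i J hi ih =>
    have hweight : ∑ S ∈ (insert i J).powerset, (3 : ℝ) ^ #S * c S ^ 2 =
        ∑ S ∈ J.powerset, 3 ^ #S * c S ^ 2 +
          3 * ∑ S ∈ J.powerset, 3 ^ #S * c (insert i S) ^ 2 := by
      rw [sum_powerset_insert hi, mul_sum]
      congr 1
      refine sum_congr rfl fun S hS => ?_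
      rw [card_insert_of_notMem fun h => hi (mem_powerset.mp hS h)]
      ring
    simp only [walshSum_powerset_insert hi, hweight]
    exact expect_add_walsh_mul_pow_four_le (walshSum_powerset_flipOn hi _)
      (walshSum_powerset_flipOn hi _) (sum_nonneg fun S _ => by positivity)
      (sum_nonneg fun S _ => by positivity) (ih _) (ih _)

lemma expect_walshSum_pow_four_le (𝒮 : Finset (Finset (Fin n))) (c : Finset (Fin n) → ℝ) :
    𝔼 x, walshSum 𝒮 c x ^ 4 ≤ (∑ S ∈ 𝒮, 3 ^ #S * c S ^ 2) ^ 2 := by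
  simpa [walshSum, ite_pow] using
    expect_walshSum_powerset_pow_four_le univ fun S => if S ∈ 𝒮 then c S else 0

/-! ### Fourier expansion and the noise operator -/

lemma noise_kernel_eq (ε : ℝ) (x y : Fin n → Bool) :
    (∏ i, if y i = x i then 1 - ε else ε) =
      (∑ S, (1 - 2 * ε) ^ #S * (walsh S y * walsh S x)) / 2 ^ n := by
  have hfactor (i : Fin n) : (if y i = x i then 1 - ε else ε) =
      (1 + (1 - 2 * ε) * ((if y i then (-1 : ℝ) else 1) * (if x i then (-1 : ℝ) else 1))) / 2 := by
    cases y i <;> cases x i <;> simp <;> ring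
  simp only [hfactor, prod_div_distrib, prod_one_add, walsh, prod_mul_distrib, prod_const,
    powerset_univ, card_univ, Fintype.card_fin]

lemma noise_eq_walshSum (ε : ℝ) (f : (Fin n → Bool) → ℝ) :
    noise ε f = walshSum univ fun S => (1 - 2 * ε) ^ #S * fourier f S := by
  funext x
  simp only [noise, noise_kernel_eq, walshSum, fourier, expect, sum_div, sum_mul, mul_sum]
  rw [sum_comm]
  exact sum_congr rfl fun S _ => sum_congr rfl fun y _ => by ring

lemma noise_zero (f : (Fin n → Bool) → ℝ) : noise 0 f = f := by
  funext x
  simp [noise, Fintype.prod_ite_zero, ← funext_iff]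

lemma walshSum_fourier (f : (Fin n → Bool) → ℝ) : walshSum univ (fourier f) = f := by
  simpa [noise_zero] using (noise_eq_walshSum 0 f).symm

lemma expect_sq_eq_sum_fourier_sq (f : (Fin n → Bool) → ℝ) :
    𝔼 x, f x ^ 2 = ∑ S, fourier f S ^ 2 := by
  simpa only [walshSum_fourier] using expect_walshSum_sq univ (fourier f)

lemma fourier_noise (ε : ℝ) (f : (Fin n → Bool) → ℝ) (S : Finset (Fin n)) :
    fourier (noise ε f) S = (1 - 2 * ε) ^ #S * fourier f S := by
  simp [noise_eq_walshSum, fourier_walshSum]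

lemma expect_noise (ε : ℝ) (f : (Fin n → Bool) → ℝ) : 𝔼 x, noise ε f x = 𝔼 x, f x := by
  simp [← fourier_empty, fourier_noise]

lemma noise_nonneg {ε : ℝ} (hε0 : 0 ≤ ε) (hε1 : ε ≤ 1) {f : (Fin n → Bool) → ℝ}
    (hf : ∀ x, 0 ≤ f x) (x : Fin n → Bool) : 0 ≤ noise ε f x :=
  sum_nonneg fun y _ => mul_nonneg (prod_nonneg fun i _ => by split_ifs <;> linarith) (hf y)

lemma noise_const_mul (ε a : ℝ) (f : (Fin n → Bool) → ℝ) :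
    noise ε (fun x => a * f x) = fun x => a * noise ε f x := by
  funext x
  simp only [noise, mul_sum, mul_left_comm]

lemma sum_pow_mul_fourier_noise_sq_le (f : (Fin n → Bool) → ℝ) {a ε : ℝ} (ha : 0 ≤ a)
    (haε : a * (1 - 2 * ε) ^ 2 ≤ 1) (k : ℕ) :
    ∑ S with k ≤ #S, a ^ #S * fourier (noise ε f) S ^ 2 ≤
      (a * (1 - 2 * ε) ^ 2) ^ k * 𝔼 x, f x ^ 2 := by
  rw [expect_sq_eq_sum_fourier_sq, mul_sum]
  refine (sum_le_sum fun S hS => ?_).trans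
    (sum_le_sum_of_subset_of_nonneg (filter_subset _ _) fun S _ _ => by positivity)
  calc a ^ #S * fourier (noise ε f) S ^ 2
      = (a * (1 - 2 * ε) ^ 2) ^ #S * fourier f S ^ 2 := by
        rw [fourier_noise, mul_pow, pow_right_comm, mul_pow, mul_assoc]
    _ ≤ (a * (1 - 2 * ε) ^ 2) ^ k * fourier f S ^ 2 := by
      gcongr ?_ * _
      exact pow_le_pow_of_le_one (by positivity) haε (mem_filter.mp hS).2

lemma expect_noise_sq_le (f : (Fin n → Bool) → ℝ) {ε : ℝ} (hε0 : 0 ≤ ε) (hε1 : ε ≤ 1) :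
    𝔼 x, noise ε f x ^ 2 ≤ 𝔼 x, f x ^ 2 := by
  simpa [expect_sq_eq_sum_fourier_sq] using
    sum_pow_mul_fourier_noise_sq_le f (ε := ε) zero_le_one (by nlinarith) 0

/-! ### Taylor bounds -/

lemma log_one_add_le {t : ℝ} (ht : -1 < t) : Real.log (1 + t) ≤ t - t ^ 2 / 2 + t ^ 3 / 3 := by
  have hderiv {s : ℝ} (hs : -1 < s) : HasDerivAt
      (fun s => s - s ^ 2 / 2 + s ^ 3 / 3 - Real.log (1 + s)) (s ^ 3 / (1 + s)) s := by
    have hne : 1 + s ≠ 0 := by linarith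
    refine ((((hasDerivAt_id s).sub ((hasDerivAt_pow 2 s).div_const 2)).add
      ((hasDerivAt_pow 3 s).div_const 3)).sub
      (((hasDerivAt_id s).const_add 1).log hne)).congr_deriv ?_
    simp only [id_eq]
    push_cast
    field_simp
    ring
  have hmin := isMinOn_Ioi_of_deriv (a := -1) (hderiv (s := 0) (by norm_num)).continuousAt
    (fun s hs => (hderiv hs.1).differentiableAt.differentiableWithinAt)
    (fun s hs => (hderiv (by linarith [hs.out])).differentiableAt.differentiableWithinAt)
    (fun s hs => by
      rw [(hderiv hs.1).deriv]
      exact div_nonpos_of_nonpos_of_nonneg (by nlinarith [sq_nonneg s, hs.2]) (by linarith [hs.1]))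
    (fun s hs => by
      have hs0 : 0 < s := hs
      rw [(hderiv (by linarith)).deriv]
      positivity)
  have := isMinOn_iff.mp hmin t ht
  norm_num at this
  linarith

lemma one_add_mul_log_one_add_le {t : ℝ} (ht : -1 ≤ t) :
    (1 + t) * Real.log (1 + t) ≤ t + t ^ 2 / 2 - t ^ 3 / 6 + t ^ 4 / 3 := by
  rcases ht.eq_or_lt with rfl | ht
  · norm_num
  · calc (1 + t) * Real.log (1 + t) ≤ (1 + t) * (t - t ^ 2 / 2 + t ^ 3 / 3) :=
          mul_le_mul_of_nonneg_left (log_one_add_le ht) (by linarith)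
      _ = t + t ^ 2 / 2 - t ^ 3 / 6 + t ^ 4 / 3 := by ring

lemma cube_sub_cube_le (a b : ℝ) :
    a ^ 3 - b ^ 3 ≤ (a - b) ^ 2 / 2 + 9 / 4 * (a ^ 4 + b ^ 4) := by
  have hquad : a ^ 2 + a * b + b ^ 2 ≤ 3 / 2 * (a ^ 2 + b ^ 2) := by
    linarith [sq_nonneg (a - b)]
  have hquad_nonneg : 0 ≤ a ^ 2 + a * b + b ^ 2 := by nlinarith [sq_nonneg (a + b)]
  have hquad_sq : (a ^ 2 + a * b + b ^ 2) ^ 2 ≤ 9 / 2 * (a ^ 4 + b ^ 4) := by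
    linarith [pow_le_pow_left₀ hquad_nonneg hquad 2, sq_nonneg (a ^ 2 - b ^ 2)]
  -- `a³ - b³ = (a - b) (a² + a b + b²)`, to which AM-GM applies.
  linarith [sq_nonneg (a - b - (a ^ 2 + a * b + b ^ 2))]

lemma one_add_mul_log_one_add_add_le {l q : ℝ} (h : -1 ≤ l + q) :
    (1 + (l + q)) * Real.log (1 + (l + q)) ≤
      (l + q) + 1 / 2 * (l + q) ^ 2 - 1 / 6 * l ^ 3 + 1 / 12 * q ^ 2
        + 17 / 24 * (l + q) ^ 4 + 3 / 8 * l ^ 4 := by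
  have hcube := cube_sub_cube_le l (l + q)
  rw [sub_add_cancel_left, neg_sq] at hcube
  linarith [one_add_mul_log_one_add_le h]

/-! ### Entropy -/

lemma ent_mul_log_two (g : (Fin n → Bool) → ℝ) :
    ent g * Real.log 2 =
      𝔼 x, g x * Real.log (g x) - (𝔼 x, g x) * Real.log (𝔼 x, g x) := by
  have hlog : Real.log 2 ≠ 0 := (Real.log_pos one_lt_two).ne'
  simp only [ent, expect_eq_finset_expect, Real.logb, ← mul_div_assoc, ← expect_div]
  field_simp

lemma ent_const_mul (a : ℝ) (g : (Fin n → Bool) → ℝ) :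
    ent (fun x => a * g x) = a * ent g := by
  have hlogb (y : ℝ) : a * y * Real.logb 2 (a * y) =
      a * (y * Real.logb 2 y) + a * Real.logb 2 a * y := by
    by_cases ha : a = 0
    · simp [ha]
    by_cases hy : y = 0
    · simp [hy]
    rw [Real.logb_mul ha hy]
    ring
  simp only [ent, expect_eq_finset_expect, ← mul_expect, hlogb, expect_add_distrib]
  ring

lemma ent_mul_log_two_le_expect_sq {g : (Fin n → Bool) → ℝ} (hg : ∀ x, 0 ≤ g x)
    (hg1 : 𝔼 x, g x = 1) : ent g * Real.log 2 ≤ 𝔼 x, g x ^ 2 := by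
  rw [ent_mul_log_two, hg1, Real.log_one, mul_zero, sub_zero]
  refine expect_le_expect fun x _ => ?_
  rw [sq]
  exact mul_le_mul_of_nonneg_left (Real.log_le_self (hg x)) (hg x)

lemma sum_eq_empty_add_sum_one_le_card {α M : Type*} [Fintype α] [AddCommMonoid M]
    (c : Finset α → M) : ∑ S, c S = c ∅ + ∑ S with 1 ≤ #S, c S := by
  classical
  rw [← add_sum_erase univ c (mem_univ ∅)]
  congr 2
  ext S
  simp [nonempty_iff_ne_empty]

lemma sum_one_le_card_eq_add {α M : Type*} [Fintype α] [AddCommMonoid M] (c : Finset α → M) :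
    ∑ S with 1 ≤ #S, c S = ∑ S with #S = 1, c S + ∑ S with 2 ≤ #S, c S := by
  classical
  rw [← sum_union (disjoint_filter.mpr fun S _ h => by omega), ← filter_or]
  congr 2
  ext S
  omega

lemma sum_card_eq_one_eq_sum_singleton {α M : Type*} [Fintype α] [AddCommMonoid M]
    (c : Finset α → M) : ∑ S with #S = 1, c S = ∑ k, c {k} := by
  simp [← powerset_univ, ← powersetCard_eq_filter, powersetCard_one]

lemma ent_mul_log_two_le {g : (Fin n → Bool) → ℝ} (hg : ∀ x, 0 ≤ g x) (hg1 : 𝔼 x, g x = 1) :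
    ent g * Real.log 2 ≤
      1 / 2 * ∑ k, fourier g {k} ^ 2 + 7 / 12 * ∑ S with 2 ≤ #S, fourier g S ^ 2
        + 13 / 12 * (∑ S with 1 ≤ #S, 3 ^ #S * fourier g S ^ 2) ^ 2 := by
  set h := walshSum {S | 1 ≤ #S} (fourier g) with hh
  set l := walshSum {S | #S = 1} (fourier g)
  set q := walshSum {S | 2 ≤ #S} (fourier g) with hq
  set W := ∑ S with 1 ≤ #S, 3 ^ #S * fourier g S ^ 2 with hW
  have hg_eq (x) : g x = 1 + h x := by
    conv_lhs => rw [← walshSum_fourier g]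
    simp [walshSum, sum_eq_empty_add_sum_one_le_card, fourier_empty, hg1, walsh, h]
  have hh_eq (x) : h x = l x + q x := sum_one_le_card_eq_add _
  have hh1 : 𝔼 x, h x = 0 := by simp [← fourier_empty, hh, fourier_walshSum]
  have hh2 : 𝔼 x, h x ^ 2 = ∑ k, fourier g {k} ^ 2 + 𝔼 x, q x ^ 2 := by
    rw [expect_walshSum_sq, expect_walshSum_sq, sum_one_le_card_eq_add,
      sum_card_eq_one_eq_sum_singleton]
  have hl3 : 𝔼 x, l x ^ 3 = 0 :=
    expect_walshSum_pow_eq_zero (fun S hS => by simp [(mem_filter.mp hS).2]) _ (by decide)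
  have hh4 : 𝔼 x, h x ^ 4 ≤ W ^ 2 := expect_walshSum_pow_four_le _ _
  have hl4 : 𝔼 x, l x ^ 4 ≤ W ^ 2 := by
    refine (expect_walshSum_pow_four_le _ _).trans ?_
    rw [hW, sum_one_le_card_eq_add]
    gcongr
    exact le_add_of_nonneg_right (sum_nonneg fun S _ => by positivity)
  have hpointwise (x) : g x * Real.log (g x) ≤
      h x + 1 / 2 * h x ^ 2 - 1 / 6 * l x ^ 3 + 1 / 12 * q x ^ 2
        + 17 / 24 * h x ^ 4 + 3 / 8 * l x ^ 4 := by
    rw [hg_eq, hh_eq]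
    exact one_add_mul_log_one_add_add_le (by linarith [hg x, hg_eq x, hh_eq x])
  rw [ent_mul_log_two, hg1, Real.log_one, mul_zero, sub_zero, ← expect_walshSum_sq, ← hq]
  refine (expect_le_expect fun x _ => hpointwise x).trans ?_
  simp only [expect_add_distrib, expect_sub_distrib, ← mul_expect, hh1, hh2, hl3]
  linarith

lemma ent_noise_mul_log_two_le {f : (Fin n → Bool) → ℝ} (hf : ∀ x, 0 ≤ f x)
    (hf1 : 𝔼 x, f x = 1) {ε l : ℝ} (hε0 : 0 ≤ ε) (hε1 : ε ≤ 1) (hl : l = (1 - 2 * ε) ^ 2)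
    (h3l : 3 * l ≤ 1) :
    ent (noise ε f) * Real.log 2 ≤
      1 / 2 * (l * ∑ k, fourier f {k} ^ 2) + 7 / 12 * (l ^ 2 * 𝔼 x, f x ^ 2)
        + 13 / 12 * (3 * l * 𝔼 x, f x ^ 2) ^ 2 := by
  have hlevel_one : ∑ k, fourier (noise ε f) {k} ^ 2 = l * ∑ k, fourier f {k} ^ 2 := by
    simp [fourier_noise, mul_pow, mul_sum, hl]
  have hhigh : ∑ S with 2 ≤ #S, fourier (noise ε f) S ^ 2 ≤ l ^ 2 * 𝔼 x, f x ^ 2 := by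
    simpa [hl] using
      sum_pow_mul_fourier_noise_sq_le f (ε := ε) zero_le_one (by linarith) 2
  have hweighted : ∑ S with 1 ≤ #S, 3 ^ #S * fourier (noise ε f) S ^ 2 ≤
      3 * l * 𝔼 x, f x ^ 2 := by
    simpa [hl] using
      sum_pow_mul_fourier_noise_sq_le f (ε := ε) zero_le_three (by linarith) 1
  refine (ent_mul_log_two_le (noise_nonneg hε0 hε1 hf) (by rw [expect_noise, hf1])).trans ?_
  rw [hlevel_one]
  gcongr

lemma ent_noise_le_of_expect_eq_one {f : (Fin n → Bool) → ℝ} (hf : ∀ x, 0 ≤ f x)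
    (hf1 : 𝔼 x, f x = 1) {ε l : ℝ} (hε0 : 0 ≤ ε) (hε1 : ε ≤ 1) (hl : l = (1 - 2 * ε) ^ 2) :
    ent (noise ε f) ≤ 1 / (2 * Real.log 2) * (∑ k, fourier f {k} ^ 2) * l
      + 11 / Real.log 2 * ((𝔼 x, f x ^ 2) ^ 2 * l ^ 2) := by
  set A := 𝔼 x, f x ^ 2
  suffices ent (noise ε f) * Real.log 2 ≤
      1 / 2 * (l * ∑ k, fourier f {k} ^ 2) + 11 * (A ^ 2 * l ^ 2) by
    refine ((le_div_iff₀ (Real.log_pos one_lt_two)).mpr this).trans_eq ?_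
    field_simp
  have hl0 : 0 ≤ l := hl ▸ sq_nonneg _
  have hA : 1 ≤ A := by simpa [hf1] using expect_mul_sq_le_sq_mul_sq univ f 1
  have hAA : A * l ^ 2 ≤ A ^ 2 * l ^ 2 := by gcongr; exact le_self_pow₀ hA two_ne_zero
  have hAl : 0 ≤ A ^ 2 * l ^ 2 := by positivity
  rcases le_total (3 * l) 1 with h3l | h3l
  · linarith [ent_noise_mul_log_two_le hf hf1 hε0 hε1 hl h3l]
  · have hent : ent (noise ε f) * Real.log 2 ≤ A :=
      (ent_mul_log_two_le_expect_sq (noise_nonneg hε0 hε1 hf) (by rw [expect_noise, hf1])).trans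
        (expect_noise_sq_le f hε0 hε1)
    have hA9 : A * 1 ≤ A * (9 * l ^ 2) := by gcongr; nlinarith
    have hmain : 0 ≤ l * ∑ k, fourier f {k} ^ 2 := by positivity
    linarith

end BoolCube

theorem lemma1p3_general {n : ℕ} {f : (Fin n → Bool) → ℝ} (hf : ∀ x, 0 ≤ f x) (hf0 : f ≠ 0)
    {ε l : ℝ} (hε0 : 0 ≤ ε) (hε1 : ε ≤ 1) (hl : l = (1 - 2 * ε) ^ 2) :
    BoolCube.ent (BoolCube.noise ε f) ≤
      1 / BoolCube.expect f *
          (1 / (2 * Real.log 2) * ∑ k : Fin n, BoolCube.fourier f {k} ^ 2) * l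
        + 11 / Real.log 2 * (BoolCube.expect (fun x => f x ^ 2) ^ 2 / BoolCube.expect f ^ 3 *
            l ^ 2) := by
  set m := BoolCube.expect f
  have hm0 : 0 < m := BoolCube.expect_pos hf hf0
  have hdensity := BoolCube.ent_noise_le_of_expect_eq_one (f := fun x => m⁻¹ * f x)
    (fun x => mul_nonneg (inv_nonneg.mpr hm0.le) (hf x))
    (by rw [← Finset.mul_expect, ← BoolCube.expect_eq_finset_expect, inv_mul_cancel₀ hm0.ne'])
    hε0 hε1 hl
  simp only [BoolCube.noise_const_mul, BoolCube.ent_const_mul, BoolCube.fourier_const_mul,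
    mul_pow, ← Finset.mul_expect, ← Finset.mul_sum, ← BoolCube.expect_eq_finset_expect] at hdensity
  refine ((inv_mul_le_iff₀ hm0).mp hdensity).trans_eq ?_
  field_simp

theorem lemma1p3 :
    ∃ C₁ C₂ : ℝ, 0 < C₁ ∧ 0 < C₂ ∧
      ∀ (n : ℕ) (f : (Fin n → Bool) → ℝ), (∀ x, 0 ≤ f x) → f ≠ 0 →
      ∀ ε l : ℝ, 0 ≤ ε → ε ≤ 1 / 2 → l = (1 - 2 * ε) ^ 2 →
        BoolCube.ent (BoolCube.noise ε f) ≤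
          1 / BoolCube.expect f *
              (1 / (2 * Real.log 2) * ∑ k : Fin n, BoolCube.fourier f {k} ^ 2) * l
            + C₁ * (BoolCube.expect (fun x => f x ^ 2) / BoolCube.expect f *
                l ^ ((4 : ℝ) / 3))
            + C₂ * (BoolCube.expect (fun x => f x ^ 2) ^ 2 / BoolCube.expect f ^ 3 *
                l ^ 2) := by
  refine ⟨1, 11 / Real.log 2, one_pos, by positivity, fun n f hf hf0 ε l hε0 hε1 hl => ?_⟩
  have hmain := lemma1p3_general hf hf0 hε0 (hε1.trans (by norm_num)) hl
  have hterm : 0 ≤ BoolCube.expect (fun x => f x ^ 2) / BoolCube.expect f * l ^ ((4 : ℝ) / 3) :=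
    mul_nonneg (div_nonneg (BoolCube.expect_nonneg fun x => sq_nonneg _)
      (BoolCube.expect_nonneg hf)) (Real.rpow_nonneg (hl ▸ sq_nonneg _) _)
  linarith
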